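/- **Theorem.** All logarithms are natural, and $D(P\,\|\,Q)$ denotes the Kullback–Leibler divergence. A distribution $Q$ on $\{0,1\}^n$ is *$T$-structured*, for a tree $T$ on $\{1,\dots,n\}$, if after rooting $T$ at a vertex $r$ (the choice of $r$ does not matter), a vector $X\sim Q$ satisfies $$\Pr[X=x]=\Pr[X_r=x_r]\prod_{i\ne r}\Pr[X_i=x_i\mid X_{\mathrm{pa}(i)}=x_{\mathrm{pa}(i)}]$$ for all $x\in\{0,1\}^n$, where $\mathrm{pa}(i)$ is the parent of $i$ (the product being read as $0$ when $\Pr[X_{\mathrm{pa}(i)}=x_{\mathrm{pa}(i)}]=0$ for some $i\ne r$). A tree $T$ is an *$\varepsilon$-approximate tree* for a distribution $P$ on $\{0,1\}^n$ if there is a $T$-structured distribution $Q$ with $$D(P\,\|\,Q)\le \varepsilon+\min_{T'}\ \min_{Q'\ T'\text{-structured}} D(P\,\|\,Q'),$$ where $T'$ ranges over all trees on $\{1,\dots,n\}$. The sample complexity of computing an $\varepsilon$-approximate tree for a general (not necessarily tree-structured) distribution on $\{0,1\}^n$ with error probability less than $1/3$ is $\Omega(n^2\varepsilon^{-2})$.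 That is, there are absolute constants $c>0$ and $\varepsilon_0>0$ such that for every $n\ge 3$ and every $0<\varepsilon\le\varepsilon_0 n$ the following holds: if a (possibly randomized) algorithm draws $N$ i.i.d. samples from an unknown distribution $P$ on $\{0,1\}^n$ and, for every such $P$, its output fails to be an $\varepsilon$-approximate tree for $P$ with probability less than $1/3$ (over the samples and the internal randomness of the algorithm), then $$N\ \ge\ c\,\frac{n^2}{\varepsilon^2}.$$ -/

import Mathlib

open scoped ENNReal

noncomputable section

namespace TreeLearning

/-- `p` is the parent of `i` when the tree `T` is rooted at `r` and its edges are oriented away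
from `r`. -/
def IsParent {n : ℕ} (T : SimpleGraph (Fin n)) (r p i : Fin n) : Prop :=
  T.Adj p i ∧ T.dist r i = T.dist r p + 1

/-- A distribution `Q` on `{0,1}ⁿ` is `T`-structured: for a rooted orientation of the tree `T`,
`Q` is the law of a vector `X` whose root coordinate has some law `π` and in which every other
coordinate `X i` is generated from the value of its parent `X (pa i)` by a stochastic matrix
`K i`, with fresh randomness:
`Q x = π (x r) * ∏_{i ≠ r} K i (x (pa i)) (x i)`.
Then `π` is the marginal of `X r`, and `K i b` is the conditional law of `X i` given
`X (pa i) = b` whenever that event has positive probability. For a tree the choice of the root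
does not affect the class of distributions obtained. -/
def IsTreeStructured {n : ℕ} (T : SimpleGraph (Fin n)) (Q : PMF (Fin n → Bool)) : Prop :=
  ∃ (r : Fin n) (pa : Fin n → Fin n), (∀ i, i ≠ r → IsParent T r (pa i) i) ∧
    ∃ (π : PMF Bool) (K : Fin n → Bool → PMF Bool),
      ∀ x : Fin n → Bool, Q x = π (x r) * ∏ i ∈ Finset.univ.erase r, K i (x (pa i)) (x i)

/-- The Kullback-Leibler divergence `D(P ‖ Q)` (in nats, equal to `∞` if `P` is not absolutely
continuous with respect to `Q`) of two distributions on `{0,1}ⁿ`. -/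
def kl {n : ℕ} (P Q : PMF (Fin n → Bool)) : ℝ≥0∞ :=
  InformationTheory.klDiv P.toMeasure Q.toMeasure

/-- `T` is an `ε`-approximate tree for `P`: it is a tree, and some `T`-structured distribution `Q`
has `D(P ‖ Q)` at most `ε` more than the best possible value over all tree-structured
distributions. -/
def IsApproxTree {n : ℕ} (P : PMF (Fin n → Bool)) (ε : ℝ) (T : SimpleGraph (Fin n)) : Prop :=
  T.IsTree ∧ ∃ Q : PMF (Fin n → Bool), IsTreeStructured T Q ∧
    ∀ (T' : SimpleGraph (Fin n)) (Q' : PMF (Fin n → Bool)),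
      T'.IsTree → IsTreeStructured T' Q' → kl P Q ≤ kl P Q' + ENNReal.ofReal ε

/-- A randomized algorithm that draws `N` samples from `{0,1}ⁿ` and outputs a graph on `n`
vertices: it assigns to each sequence of samples the law of its output. -/
abbrev Learner (n N : ℕ) : Type :=
  (Fin N → (Fin n → Bool)) → PMF (SimpleGraph (Fin n))

/-- The probability, over `N` i.i.d. samples from `P` and the internal randomness of the
algorithm `A`, that the output of `A` is not an `ε`-approximate tree for `P`. -/
def errorProb {n N : ℕ} (A : Learner n N) (P : PMF (Fin n → Bool)) (ε : ℝ) : ℝ≥0∞ :=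
  ∑ s : Fin N → (Fin n → Bool),
    (∏ j, P (s j)) * (A s).toOuterMeasure {T | ¬ IsApproxTree P ε T}

end TreeLearning

end

open scoped ENNReal

noncomputable section

namespace TreeLearning

open MeasureTheory

/-! ### Divergence on a finite space as a finite sum. -/

section KL

variable {α : Type*} [MeasurableSpace α]

/-! The lower bound is Assouad's method on `2 ^ m` distributions over two hubs and `m = n - 2`
leaves. The hubs are uniform bits agreeing with probability `3 / 4`; leaf `k` is a noisy copy of the
hub chosen by the bit `b k`. The copy has accuracy `3 / 4` when the hubs agree, which reveals
nothing about `b k`, and only `1 / 2 + δ` when they disagree. A sample thus carries information of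
order `δ ^ 2` about each bit.

A wrong hub nevertheless costs order `δ`, not `δ ^ 2`. The leaf agrees with its two hubs with
probabilities `11 / 16 ± δ / 4`, and binary entropy has nonzero slope near `11 / 16`. All these laws
are invariant under flipping every bit, so the likelihood of any structured law on a tree is bounded
by the sum of `-H(agreement)` over its edges (`sum_mul_log_le_of_structured`), with equality for a
fitted law on the hub tree (`sum_hardPMF_mul_log_starPMF`). Hence every misattached leaf loses at
least `δ / 5` (`card_ne_hubParent_le`), and with `δ` of order `ε / n` an `ε`-approximate tree
reveals all but a small fraction of the bits.

Fewer than a constant times `δ⁻²` samples leave neighbouring instances nearly indistinguishable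
(`sum_abs_prod_starDensity_sub_le`), so `exists_le_sum_test_error` forces too many wrong bits.
Therefore `N` is at least of order `δ⁻²`, that is `n ^ 2 / ε ^ 2`. -/

theorem toMeasure_absolutelyContinuous_of_pos (P Q : PMF α) (hQ : ∀ x, Q x ≠ 0) :
    P.toMeasure ≪ Q.toMeasure := by
  refine Measure.AbsolutelyContinuous.mk fun s hs h => ?_
  rw [PMF.toMeasure_apply_eq_zero_iff _ hs] at h ⊢
  have : Q.support = Set.univ := by
    ext x
    simp [hQ x]
  rw [this, Set.univ_disjoint] at h
  simp [h]

variable [MeasurableSingletonClass α]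

theorem klDiv_toMeasure_eq_top (P Q : PMF α) (x : α) (hP : P x ≠ 0) (hQ : Q x = 0) :
    InformationTheory.klDiv P.toMeasure Q.toMeasure = ∞ := by
  refine InformationTheory.klDiv_of_not_ac fun h => hP ?_
  have := h (s := {x})
  rw [PMF.toMeasure_apply_singleton _ _ (measurableSet_singleton x),
    PMF.toMeasure_apply_singleton _ _ (measurableSet_singleton x)] at this
  exact this hQ

variable [Fintype α]

theorem rnDeriv_toMeasure (P Q : PMF α) (hQ : ∀ x, Q x ≠ 0) (x : α) :
    P.toMeasure.rnDeriv Q.toMeasure x = P x / Q x := by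
  have h : P.toMeasure = Q.toMeasure.withDensity (fun x => P x / Q x) := by
    refine Measure.ext_of_singleton fun a => ?_
    rw [withDensity_apply _ (measurableSet_singleton a),
      PMF.toMeasure_apply_singleton _ _ (measurableSet_singleton a)]
    simp only [lintegral_singleton]
    rw [PMF.toMeasure_apply_singleton _ _ (measurableSet_singleton a),
      ENNReal.div_mul_cancel (hQ a) (Q.apply_ne_top a)]
  have h2 : P.toMeasure.rnDeriv Q.toMeasure =ᵐ[Q.toMeasure] fun x => P x / Q x := by
    conv_lhs => rw [h]
    exact Measure.rnDeriv_withDensity _ .of_discrete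
  have h3 : Q.toMeasure {y | ¬ (P.toMeasure.rnDeriv Q.toMeasure y = P y / Q y)} = 0 := h2
  -- Almost everywhere means everywhere here, since each point has positive mass under `Q`.
  by_contra hx
  have h4 : Q.toMeasure {x} = 0 := measure_mono_null (by simpa using hx) h3
  rw [PMF.toMeasure_apply_singleton _ _ (measurableSet_singleton x)] at h4
  exact hQ x h4

theorem klDiv_toMeasure (P Q : PMF α) (hQ : ∀ x, Q x ≠ 0) :
    InformationTheory.klDiv P.toMeasure Q.toMeasure ≠ ∞ ∧
    (InformationTheory.klDiv P.toMeasure Q.toMeasure).toReal =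
      ∑ x, (P x).toReal * Real.log ((P x).toReal / (Q x).toReal) := by
  have hac := toMeasure_absolutelyContinuous_of_pos P Q hQ
  refine ⟨InformationTheory.klDiv_ne_top hac .of_finite, ?_⟩
  rw [InformationTheory.toReal_klDiv_of_measure_eq hac (by simp), PMF.integral_eq_sum]
  refine Finset.sum_congr rfl fun x _ => ?_
  rw [llr, rnDeriv_toMeasure P Q hQ, ENNReal.toReal_div, smul_eq_mul]

/-- If `D(P ‖ Q) ≤ D(P ‖ R) + ε` where `P` and `R` have full support, then so does `Q`, and the
expected log-likelihoods satisfy the corresponding inequality. -/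
theorem sum_log_le_of_klDiv_le (P Q R : PMF α) (hP : ∀ x, P x ≠ 0) (hR : ∀ x, R x ≠ 0)
    {ε : ℝ} (hε : 0 ≤ ε)
    (h : InformationTheory.klDiv P.toMeasure Q.toMeasure ≤
      InformationTheory.klDiv P.toMeasure R.toMeasure + ENNReal.ofReal ε) :
    (∀ x, Q x ≠ 0) ∧
      ∑ x, (P x).toReal * Real.log (R x).toReal ≤
        ∑ x, (P x).toReal * Real.log (Q x).toReal + ε := by
  obtain ⟨hRt, hRe⟩ := klDiv_toMeasure P R hR
  have hQ : ∀ x, Q x ≠ 0 := by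
    intro x hx
    rw [klDiv_toMeasure_eq_top P Q x (hP x) hx] at h
    exact ENNReal.add_ne_top.2 ⟨hRt, ENNReal.ofReal_ne_top⟩ (top_le_iff.1 h)
  refine ⟨hQ, ?_⟩
  obtain ⟨hQt, hQe⟩ := klDiv_toMeasure P Q hQ
  have h2 := ENNReal.toReal_mono (ENNReal.add_ne_top.2 ⟨hRt, ENNReal.ofReal_ne_top⟩) h
  rw [ENNReal.toReal_add hRt ENNReal.ofReal_ne_top, ENNReal.toReal_ofReal hε, hRe, hQe] at h2
  have key : ∀ S : PMF α, (∀ x, S x ≠ 0) →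
      ∑ x, (P x).toReal * Real.log ((P x).toReal / (S x).toReal) =
        ∑ x, (P x).toReal * Real.log (P x).toReal -
          ∑ x, (P x).toReal * Real.log (S x).toReal := by
    intro S hS
    rw [← Finset.sum_sub_distrib]
    refine Finset.sum_congr rfl fun x _ => ?_
    rw [Real.log_div (ENNReal.toReal_ne_zero.2 ⟨hP x, P.apply_ne_top x⟩)
      (ENNReal.toReal_ne_zero.2 ⟨hS x, S.apply_ne_top x⟩), mul_sub]
  rw [key Q hQ, key R hR] at h2
  linarith

end KL

/-! ### Rooted trees and parent maps. -/

section Trees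

variable {n : ℕ}

/-- The edges of a tree are in bijection with its non-root vertices, whatever the root. -/
theorem sum_parent_edge_eq (T : SimpleGraph (Fin n)) [Fintype T.edgeSet] (hT : T.IsTree)
    (r : Fin n) (pa : Fin n → Fin n) (hpa : ∀ i, i ≠ r → IsParent T r (pa i) i)
    (w : Sym2 (Fin n) → ℝ) :
    ∑ i ∈ Finset.univ.erase r, w s(pa i, i) = ∑ e ∈ T.edgeFinset, w e := by
  classical
  -- Two vertices sharing a parent edge would each be the other's parent, hence each farther from
  -- the root than the other. Counting `n - 1` edges then gives surjectivity.
  have hinj : Set.InjOn (fun i => s(pa i, i)) (Finset.univ.erase r : Finset (Fin n)) := by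
    intro i hi j hj hij
    have hi' := (hpa i (by simpa using hi)).2
    have hj' := (hpa j (by simpa using hj)).2
    rcases Sym2.eq_iff.1 hij with ⟨_, h⟩ | ⟨h1, h2⟩
    · exact h
    · rw [h1] at hi'
      rw [← h2] at hj'
      omega
  have himg : (Finset.univ.erase r).image (fun i => s(pa i, i)) = T.edgeFinset := by
    refine Finset.eq_of_subset_of_card_le ?_ ?_
    · intro e he
      obtain ⟨i, hi, rfl⟩ := Finset.mem_image.1 he
      simpa using (hpa i (by simpa using hi)).1
    · rw [Finset.card_image_of_injOn hinj, Finset.card_erase_of_mem (Finset.mem_univ r),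
        Finset.card_univ]
      have := hT.card_edgeFinset
      omega
  rw [← himg, Finset.sum_image hinj]

theorem sum_parent_edge_eq_of_roots (T : SimpleGraph (Fin n)) (hT : T.IsTree)
    (r r' : Fin n) (pa pa' : Fin n → Fin n) (hpa : ∀ i, i ≠ r → IsParent T r (pa i) i)
    (hpa' : ∀ i, i ≠ r' → IsParent T r' (pa' i) i) (w : Sym2 (Fin n) → ℝ) :
    ∑ i ∈ Finset.univ.erase r, w s(pa i, i) = ∑ i ∈ Finset.univ.erase r', w s(pa' i, i) := by
  classical
  rw [sum_parent_edge_eq T hT r pa hpa, sum_parent_edge_eq T hT r' pa' hpa']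

theorem exists_parent (T : SimpleGraph (Fin n)) (hT : T.Connected) (r : Fin n) :
    ∃ pa : Fin n → Fin n, ∀ i, i ≠ r → IsParent T r (pa i) i := by
  have h : ∀ i, ∃ p, i ≠ r → IsParent T r p i := by
    intro i
    by_cases hi : i = r
    · exact ⟨i, fun h => absurd hi h⟩
    obtain ⟨p, hp⟩ := hT.exists_walk_length_eq_dist i r
    cases p with
    | nil => exact absurd rfl hi
    | @cons _ v _ hadj q =>
      refine ⟨v, fun _ => ⟨hadj.symm, ?_⟩⟩
      have h1 := T.dist_le q
      have h2 : T.dist i r ≤ T.dist v r + 1 := by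
        have := hT.dist_triangle (u := i) (v := v) (w := r)
        rw [SimpleGraph.dist_eq_one_iff_adj.2 hadj] at this
        omega
      rw [SimpleGraph.Walk.length_cons] at hp
      rw [T.dist_comm (u := r), T.dist_comm (u := r)]
      omega
  choose pa hpa using h
  exact ⟨pa, hpa⟩

/-- The graph joining every vertex other than `r` to its image under `pa`. -/
def parentGraph (r : Fin n) (pa : Fin n → Fin n) : SimpleGraph (Fin n) :=
  SimpleGraph.fromRel fun i j => i ≠ r ∧ pa i = j

variable {r : Fin n} {pa : Fin n → Fin n} {d : Fin n → ℕ}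

theorem parentGraph_adj (hd : ∀ i, i ≠ r → d i = d (pa i) + 1) {i : Fin n} (hi : i ≠ r) :
    (parentGraph r pa).Adj (pa i) i := by
  rw [parentGraph, SimpleGraph.fromRel_adj]
  refine ⟨fun h => ?_, Or.inr ⟨hi, rfl⟩⟩
  have := hd i hi
  rw [h] at this
  omega

theorem parentGraph_exists_walk (hr : d r = 0) (hd : ∀ i, i ≠ r → d i = d (pa i) + 1)
    (k : ℕ) (i : Fin n) (hi : d i = k) : ∃ p : (parentGraph r pa).Walk r i, p.length = k := by
  induction k generalizing i with
  | zero =>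
    by_cases h : i = r
    · subst h
      exact ⟨.nil, rfl⟩
    · have := hd i h
      omega
  | succ k ih =>
    have h : i ≠ r := by
      rintro rfl
      omega
    obtain ⟨p, hp⟩ := ih (pa i) (by have := hd i h; omega)
    exact ⟨p.concat (parentGraph_adj hd h), by simp [hp]⟩

theorem parentGraph_connected (hr : d r = 0) (hd : ∀ i, i ≠ r → d i = d (pa i) + 1) :
    (parentGraph r pa).Connected := by
  have : Nonempty (Fin n) := ⟨r⟩
  refine ⟨fun i j => ?_⟩
  obtain ⟨p, -⟩ := parentGraph_exists_walk hr hd _ i rfl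
  obtain ⟨q, -⟩ := parentGraph_exists_walk hr hd _ j rfl
  exact ⟨p.reverse.append q⟩

/-- Depth changes by exactly one along each edge, so no walk from the root beats the climb along
parents; this identifies `d` with the distance. -/
theorem parentGraph_le_add_length (hd : ∀ i, i ≠ r → d i = d (pa i) + 1) {i j : Fin n}
    (p : (parentGraph r pa).Walk i j) : d j ≤ d i + p.length := by
  induction p with
  | nil => simp
  | @cons u v w h q ih =>
    rw [parentGraph, SimpleGraph.fromRel_adj] at h
    rw [SimpleGraph.Walk.length_cons]
    rcases h.2 with ⟨h1, h2⟩ | ⟨h1, h2⟩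
    · have := hd u h1
      rw [h2] at this
      omega
    · have := hd v h1
      rw [h2] at this
      omega

theorem parentGraph_dist (hr : d r = 0) (hd : ∀ i, i ≠ r → d i = d (pa i) + 1) (i : Fin n) :
    (parentGraph r pa).dist r i = d i := by
  obtain ⟨p, hp⟩ := parentGraph_exists_walk hr hd _ i rfl
  obtain ⟨q, hq⟩ := (parentGraph_connected hr hd).exists_walk_length_eq_dist r i
  have h1 := (parentGraph r pa).dist_le p
  have h2 := parentGraph_le_add_length hd q
  omega

theorem parentGraph_isParent (hr : d r = 0) (hd : ∀ i, i ≠ r → d i = d (pa i) + 1)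
    {i : Fin n} (hi : i ≠ r) : IsParent (parentGraph r pa) r (pa i) i :=
  ⟨parentGraph_adj hd hi, by rw [parentGraph_dist hr hd, parentGraph_dist hr hd, hd i hi]⟩

theorem parentGraph_isTree (hr : d r = 0) (hd : ∀ i, i ≠ r → d i = d (pa i) + 1) :
    (parentGraph r pa).IsTree := by
  classical
  rw [SimpleGraph.isTree_iff_connected_and_card]
  have hc := parentGraph_connected hr hd
  refine ⟨hc, le_antisymm ?_ hc.card_vert_le_card_edgeSet_add_one⟩
  have hsub : (parentGraph r pa).edgeFinset ⊆ (Finset.univ.erase r).image fun i => s(pa i, i) := by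
    intro e
    induction e with
    | _ x y =>
      intro he
      rw [SimpleGraph.mem_edgeFinset, SimpleGraph.mem_edgeSet, parentGraph,
        SimpleGraph.fromRel_adj] at he
      rw [Finset.mem_image]
      rcases he.2 with ⟨h1, h2⟩ | ⟨h1, h2⟩
      · exact ⟨x, by simpa using h1, by rw [h2, Sym2.eq_swap]⟩
      · exact ⟨y, by simpa using h1, by rw [h2]⟩
  have hcard := (Finset.card_le_card hsub).trans Finset.card_image_le
  rw [Finset.card_erase_of_mem (Finset.mem_univ r), Finset.card_univ] at hcard
  have hpos : 0 < Fintype.card (Fin n) := Fintype.card_pos_iff.2 ⟨r⟩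
  rw [Nat.card_eq_fintype_card, Nat.card_eq_fintype_card, ← SimpleGraph.edgeFinset_card]
  omega

end Trees

/-! ### Gibbs' inequality and the slope of binary entropy. -/

section Gibbs

theorem mul_log_le_mul_log_add {s u : ℝ} (hs : 0 ≤ s) (hu : 0 < u) :
    s * Real.log u ≤ s * Real.log s + (u - s) := by
  rcases hs.eq_or_lt with rfl | hs
  · simp [hu.le]
  · have h := Real.log_le_sub_one_of_pos (div_pos hu hs)
    rw [Real.log_div hu.ne' hs.ne'] at h
    have h2 := mul_le_mul_of_nonneg_left h hs.le
    have h3 : s * (u / s - 1) = u - s := by field_simp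
    linarith

theorem binEntropy_eq (s : ℝ) :
    Real.binEntropy s = -(s * Real.log s + (1 - s) * Real.log (1 - s)) := by
  rw [Real.binEntropy, Real.log_inv, Real.log_inv]
  ring

theorem mul_log_add_mul_log_le {s u v : ℝ} (h0 : 0 ≤ s) (h1 : s ≤ 1) (hu : 0 < u) (hv : 0 < v)
    (huv : u + v ≤ 1) : s * Real.log u + (1 - s) * Real.log v ≤ -Real.binEntropy s := by
  have h2 := mul_log_le_mul_log_add h0 hu
  have h3 := mul_log_le_mul_log_add (sub_nonneg.2 h1) hv
  rw [binEntropy_eq]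
  linarith

/-- Quantitative strict monotonicity of the binary entropy to the right of `1/2`. -/
theorem binEntropy_sub_ge {s t : ℝ} (ht : 5 / 8 ≤ t) (hts : t ≤ s) (hs : s < 1) :
    2 / 5 * (s - t) ≤ Real.binEntropy t - Real.binEntropy s := by
  have ht1 : 0 < 1 - t := by linarith
  have ht0 : 0 < t := by linarith
  -- Gibbs' inequality puts entropy at `s` below its tangent line at `t`, whose slope `log ((1 - t)
  -- / t)` is at most `3 / 5 - 1` for `t ≥ 5 / 8`.
  have h := mul_log_add_mul_log_le (s := s) (by linarith) hs.le ht0 ht1 (by linarith)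
  have h2 := Real.log_le_sub_one_of_pos (div_pos ht1 ht0)
  rw [Real.log_div ht1.ne' ht0.ne'] at h2
  have h3 : (1 - t) / t - 1 ≤ -(2 / 5) := by
    rw [div_sub_one ht0.ne', div_le_iff₀ ht0]
    linarith
  have h4 : (s - t) * (Real.log (1 - t) - Real.log t) ≤ (s - t) * (-(2 / 5)) :=
    mul_le_mul_of_nonneg_left (by linarith) (by linarith)
  rw [binEntropy_eq t]
  linarith

end Gibbs

/-! ### Likelihood of tree-structured laws under flip-invariant distributions. -/

section Agreement

variable {n : ℕ}

/-- The probability that the coordinates `i` and `j` agree. -/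
def agreement (P : PMF (Fin n → Bool)) (i j : Fin n) : ℝ :=
  ∑ x, (P x).toReal * (if x i = x j then 1 else 0)

theorem agreement_comm (P : PMF (Fin n → Bool)) (i j : Fin n) :
    agreement P i j = agreement P j i := by
  simp only [agreement, eq_comm]

theorem sum_toReal_eq_one {α : Type*} [Fintype α] (P : PMF α) : ∑ x, (P x).toReal = 1 := by
  have h := P.tsum_coe
  rw [tsum_fintype] at h
  rw [← ENNReal.toReal_sum fun x _ => P.apply_ne_top x, h, ENNReal.toReal_one]

theorem sum_bool_flip {P : PMF (Fin n → Bool)} (hP : ∀ x, P (fun i => !x i) = P x)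
    (F : (Fin n → Bool) → ℝ) :
    ∑ x, (P x).toReal * F x = ∑ x, (P x).toReal * ((F x + F fun i => !x i) / 2) := by
  have h : ∑ x, (P x).toReal * F x = ∑ x : Fin n → Bool, (P x).toReal * F fun i => !x i := by
    refine Fintype.sum_equiv
      ⟨fun x i => !x i, fun x i => !x i, fun x => by simp, fun x => by simp⟩ _ _ fun x => ?_
    simp [hP]
  have h2 : ∑ x, (P x).toReal * ((F x + F fun i => !x i) / 2) =
      (∑ x, (P x).toReal * F x + ∑ x : Fin n → Bool, (P x).toReal * F fun i => !x i) / 2 := by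
    rw [← Finset.sum_add_distrib, Finset.sum_div]
    exact Finset.sum_congr rfl fun x _ => by ring
  rw [h2, ← h]
  ring

theorem agreement_mem (P : PMF (Fin n → Bool)) (i j : Fin n) :
    0 ≤ agreement P i j ∧ agreement P i j ≤ 1 := by
  constructor
  · exact Finset.sum_nonneg fun x _ => by split_ifs <;> simp
  · rw [← sum_toReal_eq_one P]
    exact Finset.sum_le_sum fun x _ => by split_ifs <;> simp

theorem sum_mul_ite_eq (P : PMF (Fin n → Bool)) (i j : Fin n) (a b : ℝ) :
    ∑ x, (P x).toReal * (if x i = x j then a else b) =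
      agreement P i j * a + (1 - agreement P i j) * b := by
  have h : ∑ x, (P x).toReal * (if x i = x j then a else b) =
      ∑ x, ((P x).toReal * (if x i = x j then 1 else 0) * (a - b) + (P x).toReal * b) :=
    Finset.sum_congr rfl fun x _ => by split_ifs <;> ring
  rw [h, Finset.sum_add_distrib, ← Finset.sum_mul, ← Finset.sum_mul, sum_toReal_eq_one, agreement]
  ring

/-- Averaging over the global flip makes the integrand depend only on whether the two bits agree;
Gibbs' inequality applies to each row of `K`, and the two bounds are averaged. -/
theorem sum_mul_log_le_pair {P : PMF (Fin n → Bool)} (hP : ∀ x, P (fun i => !x i) = P x)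
    (i j : Fin n) (K : Bool → Bool → ℝ) (hpos : ∀ a c, 0 < K a c)
    (hsum : ∀ a, K a true + K a false ≤ 1) :
    ∑ x, (P x).toReal * Real.log (K (x i) (x j)) ≤ -Real.binEntropy (agreement P i j) := by
  obtain ⟨h0, h1⟩ := agreement_mem P i j
  rw [sum_bool_flip hP]
  have h : ∀ x : Fin n → Bool,
      (Real.log (K (x i) (x j)) + Real.log (K (!x i) (!x j))) / 2 =
        if x i = x j then (Real.log (K true true) + Real.log (K false false)) / 2
        else (Real.log (K true false) + Real.log (K false true)) / 2 := by
    intro x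
    cases x i <;> cases x j <;> simp <;> ring
  simp only [h]
  rw [sum_mul_ite_eq]
  have ht := mul_log_add_mul_log_le h0 h1 (hpos true true) (hpos true false) (hsum true)
  have hf := mul_log_add_mul_log_le h0 h1 (hpos false false) (hpos false true)
    (by linarith [hsum false])
  linarith

theorem sum_mul_log_le_single {P : PMF (Fin n → Bool)} (hP : ∀ x, P (fun i => !x i) = P x)
    (i : Fin n) (π : Bool → ℝ) (hpos : ∀ a, 0 < π a) (hsum : π true + π false ≤ 1) :
    ∑ x, (P x).toReal * Real.log (π (x i)) ≤ -Real.log 2 := by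
  rw [sum_bool_flip hP]
  have h : ∀ x : Fin n → Bool, (Real.log (π (x i)) + Real.log (π (!x i))) / 2 =
      (Real.log (π true) + Real.log (π false)) / 2 := by
    intro x
    cases x i
    · simp [add_comm]
    · simp
  simp only [h]
  rw [← Finset.sum_mul, sum_toReal_eq_one]
  have := mul_log_add_mul_log_le (s := 1 / 2) (by norm_num) (by norm_num) (hpos true)
    (hpos false) hsum
  have h2 : Real.binEntropy (1 / 2) = Real.log 2 := by
    rw [one_div]
    exact Real.binEntropy_two_inv
  rw [h2] at this
  linarith

theorem toReal_true_add_false (p : PMF Bool) : (p true).toReal + (p false).toReal ≤ 1 := by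
  have := sum_toReal_eq_one p
  rw [Fintype.sum_bool] at this
  exact this.le

/-- The expected log-likelihood of a tree-structured distribution under a distribution that is
invariant under flipping all bits. -/
theorem sum_mul_log_le_of_structured {P Q : PMF (Fin n → Bool)}
    (hP : ∀ x, P (fun i => !x i) = P x) (hQ : ∀ x, Q x ≠ 0) {T : SimpleGraph (Fin n)}
    (hT : T.IsTree) (hs : IsTreeStructured T Q) {r' : Fin n} {pa' : Fin n → Fin n}
    (hpa' : ∀ i, i ≠ r' → IsParent T r' (pa' i) i) :
    ∑ x, (P x).toReal * Real.log (Q x).toReal ≤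
      -Real.log 2 - ∑ i ∈ Finset.univ.erase r', Real.binEntropy (agreement P (pa' i) i) := by
  obtain ⟨r, pa, hpa, π, K, hQe⟩ := hs
  have hreal : ∀ x, (Q x).toReal = (π (x r)).toReal *
      ∏ i ∈ Finset.univ.erase r, (K i (x (pa i)) (x i)).toReal := by
    intro x
    rw [hQe, ENNReal.toReal_mul, ENNReal.toReal_prod]
  have hπ : ∀ a, 0 < (π a).toReal := by
    intro a
    refine ENNReal.toReal_pos (fun h => hQ (fun _ => a) ?_) (π.apply_ne_top a)
    rw [hQe, h, zero_mul]
  have hK : ∀ i, i ≠ r → ∀ a c, 0 < (K i a c).toReal := by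
    intro i hi a c
    -- A configuration giving `i` the value `c` and its parent the value `a`, possible because `pa i
    -- ≠ i`.
    refine ENNReal.toReal_pos (fun h => hQ (fun j => if j = i then c else a) ?_)
      ((K i a).apply_ne_top c)
    rw [hQe]
    refine mul_eq_zero_of_right _ (Finset.prod_eq_zero (i := i) (by simpa using hi) ?_)
    have hne : pa i ≠ i := (hpa i hi).1.ne
    simpa [hne] using h
  have hlog : ∀ x, Real.log (Q x).toReal = Real.log (π (x r)).toReal +
      ∑ i ∈ Finset.univ.erase r, Real.log (K i (x (pa i)) (x i)).toReal := by
    intro x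
    have hne : ∀ i ∈ Finset.univ.erase r, (K i (x (pa i)) (x i)).toReal ≠ 0 := fun i hi =>
      (hK i (by simpa using hi) _ _).ne'
    rw [hreal, Real.log_mul (hπ _).ne' (Finset.prod_ne_zero_iff.2 hne), Real.log_prod hne]
  -- Agreement is symmetric, so the entropies are weights on unordered edges and their sum does not
  -- depend on the root.
  have hw : ∑ i ∈ Finset.univ.erase r, Real.binEntropy (agreement P (pa i) i) =
      ∑ i ∈ Finset.univ.erase r', Real.binEntropy (agreement P (pa' i) i) :=
    sum_parent_edge_eq_of_roots T hT r r' pa pa' hpa hpa'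
      (Sym2.lift ⟨fun i j => Real.binEntropy (agreement P i j), fun i j => by
        simp only [agreement_comm]⟩)
  rw [← hw]
  simp only [hlog, mul_add, Finset.sum_add_distrib, Finset.mul_sum]
  rw [Finset.sum_comm, sub_eq_add_neg, ← Finset.sum_neg_distrib]
  refine add_le_add (sum_mul_log_le_single hP r (fun a => (π a).toReal) hπ
    (toReal_true_add_false π)) (Finset.sum_le_sum fun i hi => ?_)
  exact sum_mul_log_le_pair hP (pa i) i (fun a c => (K i a c).toReal)
    (hK i (by simpa using hi)) (fun a => toReal_true_add_false _)

theorem sum_mul_log_le_of_isApproxTree {P R : PMF (Fin n → Bool)} {ε : ℝ} (hε : 0 ≤ ε)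
    (hP : ∀ x, P (fun i => !x i) = P x) (hP0 : ∀ x, P x ≠ 0) (hR0 : ∀ x, R x ≠ 0)
    {T T' : SimpleGraph (Fin n)} (hT : IsApproxTree P ε T) (hT' : T'.IsTree)
    (hR : IsTreeStructured T' R) {r : Fin n} {pa : Fin n → Fin n}
    (hpa : ∀ i, i ≠ r → IsParent T r (pa i) i) :
    ∑ x, (P x).toReal * Real.log (R x).toReal ≤
      -Real.log 2 - ∑ i ∈ Finset.univ.erase r, Real.binEntropy (agreement P (pa i) i) + ε := by
  obtain ⟨hTt, Q, hQ, hle⟩ := hT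
  obtain ⟨hQ0, hlog⟩ := sum_log_le_of_klDiv_le P Q R hP0 hR0 hε (hle T' R hT' hR)
  have := sum_mul_log_le_of_structured hP hQ0 hTt hQ hpa
  linarith

end Agreement

/-! ### Pair marginals of mixtures of product laws. -/

section Mixture

variable {ι S : Type*} [Fintype ι] [DecidableEq ι] [Fintype S]

theorem sum_prod_eq_one {f : ι → Bool → ℝ} (hf : ∀ i, ∑ a, f i a = 1) :
    ∑ x : ι → Bool, ∏ i, f i (x i) = 1 := by
  have h := Finset.prod_univ_sum (fun _ : ι => (Finset.univ : Finset Bool)) f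
  rw [Fintype.piFinset_univ] at h
  rw [← h]
  exact Finset.prod_eq_one fun i _ => hf i

/-- Expanding `F` in indicators of the two values keeps each summand a product over coordinates, so
the sum over the cube factorizes. -/
theorem sum_prod_mul_pair {f : ι → Bool → ℝ} (hf : ∀ i, ∑ a, f i a = 1) {i j : ι} (hij : i ≠ j)
    (F : Bool → Bool → ℝ) :
    ∑ x : ι → Bool, (∏ k, f k (x k)) * F (x i) (x j) = ∑ a, ∑ c, f i a * f j c * F a c := by
  have hF : ∀ x : ι → Bool, (∏ k, f k (x k)) * F (x i) (x j) =
      ∑ a, ∑ c, F a c * ∏ k, f k (x k) *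
        (if k = i then (if x k = a then 1 else 0) else
          if k = j then (if x k = c then 1 else 0) else 1) := by
    intro x
    have h : ∀ a c, ∏ k, (if k = i then (if x k = a then (1 : ℝ) else 0) else
          if k = j then (if x k = c then 1 else 0) else 1) =
        (if x i = a then 1 else 0) * (if x j = c then 1 else 0) := by
      intro a c
      rw [← Finset.mul_prod_erase _ _ (Finset.mem_univ i),
        ← Finset.mul_prod_erase _ _ (Finset.mem_erase.2 ⟨hij.symm, Finset.mem_univ j⟩),
        Finset.prod_eq_one]
      · simp [hij.symm]
      · intro k hk
        simp only [Finset.mem_erase] at hk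
        simp [hk.1, hk.2.1]
    simp only [Finset.prod_mul_distrib, h]
    rw [Finset.sum_eq_single (x i), Finset.sum_eq_single (x j)]
    · simp [mul_comm]
    · intro c _ hc
      simp [hc.symm]
    · simp
    · intro a _ ha
      simp [ha.symm]
    · simp
  simp only [hF]
  rw [Finset.sum_comm]
  refine Finset.sum_congr rfl fun a _ => ?_
  rw [Finset.sum_comm]
  refine Finset.sum_congr rfl fun c _ => ?_
  rw [← Finset.mul_sum]
  have h := Finset.prod_univ_sum (fun _ : ι => (Finset.univ : Finset Bool)) fun k y => f k y *
        (if k = i then (if y = a then (1 : ℝ) else 0) else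
          if k = j then (if y = c then 1 else 0) else 1)
  rw [Fintype.piFinset_univ] at h
  rw [← h, ← Finset.mul_prod_erase _ _ (Finset.mem_univ i),
    ← Finset.mul_prod_erase _ _ (Finset.mem_erase.2 ⟨hij.symm, Finset.mem_univ j⟩),
    Finset.prod_eq_one]
  · simp [hij.symm]
    ring
  · intro k hk
    simp only [Finset.mem_erase] at hk
    simp only [hk.1, hk.2.1, if_false, mul_one]
    exact hf k

theorem sum_mixture_eq {p : S → ℝ} {q : ι → S → Bool → ℝ} (hp : ∑ s, p s = 1)
    (hq : ∀ i s, ∑ a, q i s a = 1) : ∑ x : ι → Bool, ∑ s, p s * ∏ i, q i s (x i) = 1 := by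
  rw [Finset.sum_comm]
  simp only [← Finset.mul_sum, sum_prod_eq_one fun i => hq i _, mul_one, hp]

theorem sum_mixture_mul_pair {p : S → ℝ} {q : ι → S → Bool → ℝ}
    (hq : ∀ i s, ∑ a, q i s a = 1) {i j : ι} (hij : i ≠ j) (F : Bool → Bool → ℝ) :
    ∑ x : ι → Bool, (∑ s, p s * ∏ i, q i s (x i)) * F (x i) (x j) =
      ∑ s, p s * ∑ a, ∑ c, q i s a * q j s c * F a c := by
  simp only [Finset.sum_mul]
  rw [Finset.sum_comm]
  refine Finset.sum_congr rfl fun s _ => ?_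
  rw [← sum_prod_mul_pair (fun k => hq k s) hij, Finset.mul_sum]
  exact Finset.sum_congr rfl fun x _ => by ring

end Mixture

/-! ### Two hubs with conditionally independent leaves. -/

section Star

variable {m : ℕ}

/-- The transition matrix of the binary symmetric channel that copies a bit with probability
`t`. -/
def bsc (t : ℝ) (a c : Bool) : ℝ := if a = c then t else 1 - t

theorem bsc_pos {t : ℝ} (h0 : 0 < t) (h1 : t < 1) (a c : Bool) : 0 < bsc t a c := by
  unfold bsc
  split_ifs <;> linarith

theorem bsc_nonneg {t : ℝ} (h0 : 0 ≤ t) (h1 : t ≤ 1) (a c : Bool) : 0 ≤ bsc t a c := by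
  unfold bsc
  split_ifs <;> linarith

theorem sum_bsc (t : ℝ) (a : Bool) : ∑ c, bsc t a c = 1 := by
  cases a <;> simp [bsc]

theorem bsc_not (t : ℝ) (a c : Bool) : bsc t (!a) (!c) = bsc t a c := by
  simp [bsc]

/-- The joint law of the two hubs: uniform bits that agree with probability `3 / 4`. -/
def hubWeight (s : Bool × Bool) : ℝ := bsc (3 / 4) s.1 s.2 / 2

theorem hubWeight_pos (s : Bool × Bool) : 0 < hubWeight s :=
  half_pos (bsc_pos (by norm_num) (by norm_num) _ _)

theorem sum_hubWeight : ∑ s, hubWeight s = 1 := by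
  rw [Fintype.sum_prod_type]
  simp [hubWeight, bsc]
  norm_num

/-- The channel of a leaf which copies the hub `0` (if `b = false`) or the hub `1`
(if `b = true`) with a probability `t` that may depend on the values of the two hubs. -/
def leafChannel (t : Bool × Bool → ℝ) (b : Bool) (s : Bool × Bool) (a : Bool) : ℝ :=
  bsc (t s) (if b then s.2 else s.1) a

/-- The channels generating all vertices from the values of the two hubs. -/
def vertexChannel (t : Bool × Bool → ℝ) (b : Fin m → Bool) :
    Fin (m + 2) → Bool × Bool → Bool → ℝ :=
  Fin.cons (fun s => bsc 1 s.1) (Fin.cons (fun s => bsc 1 s.2) fun k => leafChannel t (b k))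

theorem vertexChannel_zero (t : Bool × Bool → ℝ) (b : Fin m → Bool) :
    vertexChannel t b 0 = fun s => bsc 1 s.1 := rfl

theorem vertexChannel_one (t : Bool × Bool → ℝ) (b : Fin m → Bool) :
    vertexChannel t b 1 = fun s => bsc 1 s.2 := rfl

theorem vertexChannel_leaf (t : Bool × Bool → ℝ) (b : Fin m → Bool) (k : Fin m) :
    vertexChannel t b k.succ.succ = leafChannel t (b k) := rfl

theorem sum_vertexChannel (t : Bool × Bool → ℝ) (b : Fin m → Bool) (i : Fin (m + 2))
    (s : Bool × Bool) : ∑ a, vertexChannel t b i s a = 1 := by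
  induction i using Fin.cases with
  | zero => exact sum_bsc _ _
  | succ i =>
    induction i using Fin.cases with
    | zero => exact sum_bsc _ _
    | succ i => exact sum_bsc _ _

/-- The density of the distribution on two hubs and `m` leaves in which every leaf is generated
from the two hubs by its own channel. -/
def starDensity (t : Bool × Bool → ℝ) (b : Fin m → Bool) (x : Fin (m + 2) → Bool) : ℝ :=
  hubWeight (x 0, x 1) * ∏ k, leafChannel t (b k) (x 0, x 1) (x k.succ.succ)

/-- The noiseless channels `bsc 1` at the hubs kill every hub state except `(x 0, x 1)`. Hubs and
leaves are then on the same footing, and one formula gives all pairwise agreements. -/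
theorem starDensity_eq_mixture (t : Bool × Bool → ℝ) (b : Fin m → Bool) (x : Fin (m + 2) → Bool) :
    starDensity t b x = ∑ s, hubWeight s * ∏ i, vertexChannel t b i s (x i) := by
  rw [Finset.sum_eq_single (x 0, x 1)]
  · rw [Fin.prod_univ_succ, Fin.prod_univ_succ]
    simp [vertexChannel_zero, vertexChannel_one, vertexChannel_leaf, bsc, starDensity]
  · rintro ⟨y, z⟩ - hs
    rw [Fin.prod_univ_succ, Fin.prod_univ_succ]
    simp only [vertexChannel_zero, Fin.succ_zero_eq_one, vertexChannel_one, bsc]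
    by_cases hy : y = x 0
    · have hz : z ≠ x 1 := fun hz => hs (by rw [hy, hz])
      simp [hz]
    · simp [hy]
  · simp

theorem sum_starDensity (t : Bool × Bool → ℝ) (b : Fin m → Bool) : ∑ x, starDensity t b x = 1 := by
  simp only [starDensity_eq_mixture]
  exact sum_mixture_eq sum_hubWeight (sum_vertexChannel t b)

theorem starDensity_pos {t : Bool × Bool → ℝ} (h0 : ∀ s, 0 < t s) (h1 : ∀ s, t s < 1)
    (b : Fin m → Bool) (x : Fin (m + 2) → Bool) : 0 < starDensity t b x :=
  mul_pos (hubWeight_pos _) (Finset.prod_pos fun _ _ => bsc_pos (h0 _) (h1 _) _ _)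

theorem starDensity_not {t : Bool × Bool → ℝ} (ht : ∀ s, t (!s.1, !s.2) = t s)
    (b : Fin m → Bool) (x : Fin (m + 2) → Bool) :
    starDensity t b (fun i => !x i) = starDensity t b x := by
  unfold starDensity
  congr 1
  · simp [hubWeight, bsc_not]
  · refine Finset.prod_congr rfl fun k _ => ?_
    have := ht (x 0, x 1)
    simp only at this
    rw [leafChannel, leafChannel, this, ← bsc_not]
    cases b k <;> simp

/-- The distribution with density `starDensity t b`. -/
def starPMF (t : Bool × Bool → ℝ) (h0 : ∀ s, 0 < t s) (h1 : ∀ s, t s < 1) (b : Fin m → Bool) :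
    PMF (Fin (m + 2) → Bool) :=
  PMF.ofFintype (fun x => ENNReal.ofReal (starDensity t b x)) (by
    rw [← ENNReal.ofReal_sum_of_nonneg fun x _ => (starDensity_pos h0 h1 b x).le,
      sum_starDensity, ENNReal.ofReal_one])

variable {t : Bool × Bool → ℝ} {h0 : ∀ s, 0 < t s} {h1 : ∀ s, t s < 1} {b : Fin m → Bool}

theorem starPMF_apply (x : Fin (m + 2) → Bool) :
    starPMF t h0 h1 b x = ENNReal.ofReal (starDensity t b x) := rfl

theorem toReal_starPMF (x : Fin (m + 2) → Bool) :
    (starPMF t h0 h1 b x).toReal = starDensity t b x :=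
  ENNReal.toReal_ofReal (starDensity_pos h0 h1 b x).le

theorem starPMF_ne_zero (x : Fin (m + 2) → Bool) : starPMF t h0 h1 b x ≠ 0 := by
  rw [starPMF_apply, Ne, ENNReal.ofReal_eq_zero, not_le]
  exact starDensity_pos h0 h1 b x

theorem agreement_starPMF {i j : Fin (m + 2)} (hij : i ≠ j) :
    agreement (starPMF t h0 h1 b) i j =
      ∑ s, hubWeight s * ∑ a, vertexChannel t b i s a * vertexChannel t b j s a := by
  simp only [agreement, toReal_starPMF, starDensity_eq_mixture]
  rw [sum_mixture_mul_pair (sum_vertexChannel t b) hij fun a c => if a = c then 1 else 0]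
  simp

theorem agreement_hubs : agreement (starPMF t h0 h1 b) 0 1 = 3 / 4 := by
  rw [agreement_starPMF (by simp), Fintype.sum_prod_type]
  simp only [vertexChannel_zero, vertexChannel_one, hubWeight, Fintype.sum_bool, bsc]
  norm_num

end Star

/-! ### The hard instances and their pairwise agreements. -/

section Hard

variable {m : ℕ}

/-- The copying probability of the leaves in the hard instances. -/
def hardCopy (δ : ℝ) (s : Bool × Bool) : ℝ := if s.1 = s.2 then 3 / 4 else 1 / 2 + δ

theorem hardCopy_pos {δ : ℝ} (hδ : 0 < δ) (s : Bool × Bool) : 0 < hardCopy δ s := by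
  unfold hardCopy
  split_ifs <;> linarith

theorem hardCopy_lt_one {δ : ℝ} (hδ : δ ≤ 1 / 4) (s : Bool × Bool) : hardCopy δ s < 1 := by
  unfold hardCopy
  split_ifs <;> linarith

theorem hardCopy_not (δ : ℝ) (s : Bool × Bool) : hardCopy δ (!s.1, !s.2) = hardCopy δ s := by
  simp [hardCopy]

/-- The hard instances: `b k` says which of the two hubs the leaf `k` is more correlated with. -/
def hardPMF {δ : ℝ} (hδ : 0 < δ) (hδ' : δ ≤ 1 / 4) (b : Fin m → Bool) :
    PMF (Fin (m + 2) → Bool) :=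
  starPMF (hardCopy δ) (hardCopy_pos hδ) (hardCopy_lt_one hδ') b

variable {δ : ℝ} {hδ : 0 < δ} {hδ' : δ ≤ 1 / 4} {b : Fin m → Bool}

/-- The hubs agree with weight `3 / 4` and contribute `9 / 16`; the rest is a quarter of `1 / 2 ±
δ`. -/
theorem agreement_hub_zero_leaf (k : Fin m) : agreement (hardPMF hδ hδ' b) 0 k.succ.succ =
    if b k then 11 / 16 - δ / 4 else 11 / 16 + δ / 4 := by
  rw [hardPMF, agreement_starPMF (Fin.succ_ne_zero _).symm, Fintype.sum_prod_type]
  simp only [vertexChannel_zero, vertexChannel_leaf, hubWeight, Fintype.sum_bool, bsc, leafChannel,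
    hardCopy]
  cases b k <;> norm_num <;> ring

theorem agreement_hub_one_leaf (k : Fin m) : agreement (hardPMF hδ hδ' b) 1 k.succ.succ =
    if b k then 11 / 16 + δ / 4 else 11 / 16 - δ / 4 := by
  rw [hardPMF, agreement_starPMF (by simp [Fin.ext_iff]), Fintype.sum_prod_type]
  simp only [vertexChannel_one, vertexChannel_leaf, hubWeight, Fintype.sum_bool, bsc, leafChannel,
    hardCopy]
  cases b k <;> norm_num <;> ring

theorem agreement_leaf_leaf {k l : Fin m} (hkl : k ≠ l) :
    agreement (hardPMF hδ hδ' b) k.succ.succ l.succ.succ =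
      if b k = b l then 19 / 32 + δ ^ 2 / 2 else 19 / 32 - δ ^ 2 / 2 := by
  rw [hardPMF, agreement_starPMF (by simpa using hkl), Fintype.sum_prod_type]
  simp only [vertexChannel_leaf, hubWeight, Fintype.sum_bool, bsc, leafChannel, hardCopy]
  cases b k <;> cases b l <;> norm_num <;> ring

theorem toReal_hardPMF (x : Fin (m + 2) → Bool) :
    (hardPMF hδ hδ' b x).toReal = starDensity (hardCopy δ) b x :=
  toReal_starPMF x

theorem hardPMF_not (x : Fin (m + 2) → Bool) :
    hardPMF hδ hδ' b (fun i => !x i) = hardPMF hδ hδ' b x := by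
  rw [hardPMF, starPMF_apply, starPMF_apply, starDensity_not (hardCopy_not δ)]

end Hard

/-! ### The hub tree and the cost of misattached leaves. -/

section BestTree

variable {m : ℕ}

/-- The binary symmetric channel as a stochastic matrix. -/
def bscPMF (t : ℝ) (h0 : 0 ≤ t) (h1 : t ≤ 1) (a : Bool) : PMF Bool :=
  PMF.ofFintype (fun c => ENNReal.ofReal (bsc t a c)) (by
    rw [← ENNReal.ofReal_sum_of_nonneg fun c _ => bsc_nonneg h0 h1 a c, sum_bsc,
      ENNReal.ofReal_one])

/-- The parents of the vertices in the tree that joins the two hubs and attaches every leaf to its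
preferred hub, rooted at the hub `0`. -/
def hubParent (b : Fin m → Bool) : Fin (m + 2) → Fin (m + 2) :=
  Fin.cons 0 (Fin.cons 0 fun k => if b k then 1 else 0)

/-- The depths of the vertices in the tree with parents `hubParent b`. -/
def hubDepth (b : Fin m → Bool) : Fin (m + 2) → ℕ :=
  Fin.cons 0 (Fin.cons 1 fun k => if b k then 2 else 1)

theorem hubParent_leaf (b : Fin m → Bool) (k : Fin m) :
    hubParent b k.succ.succ = if b k then 1 else 0 := rfl

theorem hubDepth_zero (b : Fin m → Bool) : hubDepth b 0 = 0 := rfl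

theorem hubDepth_leaf (b : Fin m → Bool) (k : Fin m) :
    hubDepth b k.succ.succ = if b k then 2 else 1 := rfl

theorem hubDepth_eq (b : Fin m → Bool) (i : Fin (m + 2)) (hi : i ≠ 0) :
    hubDepth b i = hubDepth b (hubParent b i) + 1 := by
  induction i using Fin.cases with
  | zero => exact absurd rfl hi
  | succ i =>
    induction i using Fin.cases with
    | zero => rfl
    | succ k =>
      rw [hubParent_leaf, hubDepth_leaf]
      cases b k <;> rfl

theorem sum_erase_zero {M : Type*} [AddCommMonoid M] (f : Fin (m + 2) → M) :
    ∑ i ∈ Finset.univ.erase 0, f i = f 1 + ∑ k : Fin m, f k.succ.succ := by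
  have h : (Finset.univ.erase 0 : Finset (Fin (m + 2))) =
      Finset.univ.map (Fin.succEmb (m + 1)) := by
    ext i
    induction i using Fin.cases with
    | zero => simp
    | succ i => simp
  rw [h, Finset.sum_map, Fin.sum_univ_succ]
  rfl

theorem prod_erase_zero {M : Type*} [CommMonoid M] (f : Fin (m + 2) → M) :
    ∏ i ∈ Finset.univ.erase 0, f i = f 1 * ∏ k : Fin m, f k.succ.succ :=
  sum_erase_zero (M := Additive M) f

/-- With constant accuracy a leaf depends on its own hub only, which is the factorization along the
hub tree. -/
theorem starPMF_const_isTreeStructured {t : ℝ} (h0 : 0 < t) (h1 : t < 1) (b : Fin m → Bool) :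
    IsTreeStructured (parentGraph 0 (hubParent b))
      (starPMF (fun _ => t) (fun _ => h0) (fun _ => h1) b) := by
  refine ⟨0, hubParent b, fun i hi => parentGraph_isParent (hubDepth_zero b) (hubDepth_eq b) hi,
    bscPMF (1 / 2) (by norm_num) (by norm_num) true,
    Fin.cons (bscPMF (1 / 2) (by norm_num) (by norm_num))
      (Fin.cons (bscPMF (3 / 4) (by norm_num) (by norm_num)) fun _ => bscPMF t h0.le h1.le),
    fun x => ?_⟩
  rw [prod_erase_zero, starPMF_apply, starDensity, hubWeight]
  have hπ : bscPMF (1 / 2) (by norm_num) (by norm_num) true (x 0) = ENNReal.ofReal (1 / 2) := by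
    change ENNReal.ofReal (bsc (1 / 2) true (x 0)) = _
    congr 1
    cases x 0 <;> norm_num [bsc]
  have hk : ∀ k : Fin m, leafChannel (fun _ => t) (b k) (x 0, x 1) (x k.succ.succ) =
      bsc t (x (hubParent b k.succ.succ)) (x k.succ.succ) := by
    intro k
    rw [hubParent_leaf, leafChannel]
    cases b k <;> rfl
  simp only [hk]
  rw [hπ]
  change _ = ENNReal.ofReal (1 / 2) * (ENNReal.ofReal (bsc (3 / 4) (x 0) (x 1)) *
    ∏ k : Fin m, ENNReal.ofReal (bsc t (x (hubParent b k.succ.succ)) (x k.succ.succ)))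
  rw [← ENNReal.ofReal_prod_of_nonneg fun k _ => bsc_nonneg h0.le h1.le _ _,
    ← ENNReal.ofReal_mul (bsc_nonneg (by norm_num) (by norm_num) _ _),
    ← ENNReal.ofReal_mul (by norm_num)]
  congr 1
  ring

theorem sum_mul_log_bsc {n : ℕ} (P : PMF (Fin n → Bool)) (i j : Fin n) :
    ∑ x, (P x).toReal * Real.log (bsc (agreement P i j) (x i) (x j)) =
      -Real.binEntropy (agreement P i j) := by
  have h : ∀ x : Fin n → Bool, Real.log (bsc (agreement P i j) (x i) (x j)) =
      if x i = x j then Real.log (agreement P i j) else Real.log (1 - agreement P i j) := by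
    intro x
    unfold bsc
    split_ifs <;> rfl
  simp only [h]
  rw [sum_mul_ite_eq, binEntropy_eq, neg_neg]

variable {δ : ℝ} {hδ : 0 < δ} {hδ' : δ ≤ 1 / 4} {b : Fin m → Bool}

theorem agreement_hubParent (k : Fin m) :
    agreement (hardPMF hδ hδ' b) (hubParent b k.succ.succ) k.succ.succ = 11 / 16 + δ / 4 := by
  rw [hubParent_leaf]
  split_ifs with h
  · rw [agreement_hub_one_leaf, if_pos h]
  · rw [agreement_hub_zero_leaf, if_neg h]

/-- Every channel parameter of the fitted law equals the agreement along the corresponding edge, so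
each edge contributes exactly minus its entropy. -/
theorem sum_hardPMF_mul_log_starPMF (h0 : 0 < 11 / 16 + δ / 4) (h1 : 11 / 16 + δ / 4 < 1) :
    ∑ x, (hardPMF hδ hδ' b x).toReal *
        Real.log (starPMF (fun _ => 11 / 16 + δ / 4) (fun _ => h0) (fun _ => h1) b x).toReal =
      -Real.log 2 - Real.binEntropy (3 / 4) - m * Real.binEntropy (11 / 16 + δ / 4) := by
  have hlog : ∀ x : Fin (m + 2) → Bool,
      Real.log (starPMF (fun _ => 11 / 16 + δ / 4) (fun _ => h0) (fun _ => h1) b x).toReal =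
        -Real.log 2 + Real.log (bsc (agreement (hardPMF hδ hδ' b) 0 1) (x 0) (x 1)) +
          ∑ k : Fin m, Real.log (bsc
            (agreement (hardPMF hδ hδ' b) (hubParent b k.succ.succ) k.succ.succ)
            (x (hubParent b k.succ.succ)) (x k.succ.succ)) := by
    intro x
    have hk : ∀ k : Fin m,
        leafChannel (fun _ => 11 / 16 + δ / 4) (b k) (x 0, x 1) (x k.succ.succ) =
          bsc (11 / 16 + δ / 4) (x (hubParent b k.succ.succ)) (x k.succ.succ) := by
      intro k
      rw [hubParent_leaf, leafChannel]
      cases b k <;> rfl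
    simp only [agreement_hubParent]
    rw [toReal_starPMF, starDensity, hubWeight, hardPMF, agreement_hubs]
    simp only [hk]
    have hp : ∀ k ∈ Finset.univ, bsc (11 / 16 + δ / 4) (x (hubParent b (Fin.succ (Fin.succ k))))
        (x k.succ.succ) ≠ 0 := fun k _ => (bsc_pos h0 h1 _ _).ne'
    have h34 : bsc (3 / 4) (x 0) (x 1) ≠ 0 := (bsc_pos (by norm_num) (by norm_num) _ _).ne'
    rw [Real.log_mul (div_ne_zero h34 two_ne_zero) (Finset.prod_ne_zero_iff.2 hp),
      Real.log_prod hp, Real.log_div h34 two_ne_zero]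
    ring
  simp only [hlog, mul_add, Finset.sum_add_distrib, Finset.mul_sum]
  rw [Finset.sum_comm, ← Finset.sum_mul, sum_toReal_eq_one, sum_mul_log_bsc]
  simp only [sum_mul_log_bsc]
  simp only [agreement_hubParent]
  rw [hardPMF, agreement_hubs]
  simp
  ring

/-- The tight case is two leaves: `19 / 32 + δ ^ 2 / 2 ≤ 11 / 16 - δ / 4`, with equality at `δ = 1 /
4`. -/
theorem agreement_leaf_mem (j : Fin (m + 2)) (k : Fin m) (hj : j ≠ k.succ.succ) :
    1 / 2 ≤ agreement (hardPMF hδ hδ' b) j k.succ.succ ∧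
      agreement (hardPMF hδ hδ' b) j k.succ.succ ≤
        if j = hubParent b k.succ.succ then 11 / 16 + δ / 4 else 11 / 16 - δ / 4 := by
  rw [hubParent_leaf]
  induction j using Fin.cases with
  | zero =>
    rw [agreement_hub_zero_leaf]
    cases b k <;> norm_num <;> linarith
  | succ j =>
    induction j using Fin.cases with
    | zero =>
      rw [Fin.succ_zero_eq_one, agreement_hub_one_leaf]
      cases b k <;> norm_num <;> linarith
    | succ l =>
      have hne : ¬ l.succ.succ = if b k then (1 : Fin (m + 2)) else 0 := by
        intro h
        have h2 := congrArg Fin.val h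
        cases hb : b k <;> simp [hb] at h2
      rw [agreement_leaf_leaf (by simpa using hj), if_neg hne]
      split_ifs <;> constructor <;> nlinarith

theorem binEntropy_anti {s t : ℝ} (hs : 1 / 2 ≤ s) (hst : s ≤ t) (ht : t ≤ 1) :
    Real.binEntropy t ≤ Real.binEntropy s :=
  Real.binEntropy_strictAntiOn.antitoneOn ⟨by linarith, by linarith⟩ ⟨by linarith, ht⟩ hst

/-- The number of leaves that an `ε`-approximate tree, rooted at the hub `0`, attaches to a vertex
other than the preferred hub. -/
theorem card_ne_hubParent_le {ε : ℝ} (hε : 0 ≤ ε) {T : SimpleGraph (Fin (m + 2))}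
    (hT : IsApproxTree (hardPMF hδ hδ' b) ε T) {pa : Fin (m + 2) → Fin (m + 2)}
    (hpa : ∀ i, i ≠ 0 → IsParent T 0 (pa i) i) :
    δ / 5 * ∑ k : Fin m, (if pa k.succ.succ = hubParent b k.succ.succ then 0 else 1) ≤ ε := by
  have h0 : 0 < 11 / 16 + δ / 4 := by linarith
  have h1 : 11 / 16 + δ / 4 < 1 := by linarith
  have h := sum_mul_log_le_of_isApproxTree hε hardPMF_not starPMF_ne_zero
    (starPMF_ne_zero (h0 := fun _ => h0) (h1 := fun _ => h1)) hT
    (parentGraph_isTree (hubDepth_zero b) (hubDepth_eq b))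
    (starPMF_const_isTreeStructured h0 h1 b) hpa
  rw [sum_hardPMF_mul_log_starPMF h0 h1, sum_erase_zero] at h
  -- The hub pair has the largest agreement any edge at hub `1` can have, so no saving there can
  -- offset a misattached leaf.
  have hhub : Real.binEntropy (3 / 4) ≤
      Real.binEntropy (agreement (hardPMF hδ hδ' b) (pa 1) 1) := by
    have hne : pa 1 ≠ 1 := (hpa 1 (by simp)).1.ne
    revert hne
    generalize pa 1 = j
    intro hne
    induction j using Fin.cases with
    | zero => rw [hardPMF, agreement_hubs]
    | succ j =>
      induction j using Fin.cases with
      | zero => exact absurd rfl hne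
      | succ l =>
        rw [agreement_comm]
        obtain ⟨h2, h3⟩ := agreement_leaf_mem (hδ := hδ) (hδ' := hδ') (b := b) 1 l
          (by simp [Fin.ext_iff])
        refine binEntropy_anti h2 (h3.trans ?_) (by norm_num)
        split_ifs <;> linarith
  have hleaf : ∀ k : Fin m, Real.binEntropy (11 / 16 + δ / 4) +
      δ / 5 * (if pa k.succ.succ = hubParent b k.succ.succ then 0 else 1) ≤
        Real.binEntropy (agreement (hardPMF hδ hδ' b) (pa k.succ.succ) k.succ.succ) := by
    intro k
    obtain ⟨h2, h3⟩ := agreement_leaf_mem (hδ := hδ) (hδ' := hδ') (b := b) (pa k.succ.succ) k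
      (hpa k.succ.succ (Fin.succ_ne_zero _)).1.ne
    split_ifs at h3 ⊢ with hk
    · rw [mul_zero, add_zero]
      exact binEntropy_anti h2 h3 h1.le
    -- Since `δ ≤ 1 / 4`, the smaller argument is at least `5 / 8`; the gap `δ / 2` times the slope
    -- `2 / 5` is `δ / 5`.
    · have h4 := binEntropy_sub_ge (s := 11 / 16 + δ / 4) (t := 11 / 16 - δ / 4) (by linarith)
        (by linarith) h1
      have h5 := binEntropy_anti h2 h3 (by linarith)
      linarith
  have hsum := Finset.sum_le_sum fun k (_ : k ∈ Finset.univ) => hleaf k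
  rw [Finset.sum_add_distrib, ← Finset.mul_sum] at hsum
  simp only [Finset.sum_const, Finset.card_univ, Fintype.card_fin, nsmul_eq_mul] at hsum
  linarith

end BestTree

/-! ### Distance between laws of samples via `χ²`. -/

section TotalVariation

variable {Ω : Type*} [Fintype Ω]

theorem sum_pi_prod_eq_one {P : Ω → ℝ} (hP : ∑ x, P x = 1) (N : ℕ) :
    ∑ s : Fin N → Ω, ∏ j, P (s j) = 1 := by
  rw [← Fintype.sum_pow, hP, one_pow]

theorem sum_sub_sq_div {P Q : Ω → ℝ} (hQ0 : ∀ x, 0 < Q x) (hP : ∑ x, P x = 1)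
    (hQ : ∑ x, Q x = 1) : ∑ x, (P x - Q x) ^ 2 / Q x = ∑ x, P x ^ 2 / Q x - 1 := by
  have h : ∀ x, (P x - Q x) ^ 2 / Q x = P x ^ 2 / Q x - 2 * P x + Q x := by
    intro x
    have := (hQ0 x).ne'
    field_simp
    ring
  simp only [h, Finset.sum_add_distrib, Finset.sum_sub_distrib, ← Finset.mul_sum, hP, hQ]
  ring

/-- The `L¹` distance of the laws of `N` samples from two distributions with bounded likelihood
ratio, by tensorization of the `χ²` divergence. -/
theorem sq_sum_abs_prod_sub_prod_le {P Q : Ω → ℝ} (hQ0 : ∀ x, 0 < Q x) (hP : ∑ x, P x = 1)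
    (hQ : ∑ x, Q x = 1) {η : ℝ} (h : ∀ x, |P x - Q x| ≤ η * Q x) (N : ℕ) :
    (∑ s : Fin N → Ω, |∏ j, P (s j) - ∏ j, Q (s j)|) ^ 2 ≤ (1 + η ^ 2) ^ N - 1 := by
  have hQN : ∀ s : Fin N → Ω, 0 < ∏ j, Q (s j) := fun s => Finset.prod_pos fun j _ => hQ0 _
  have hchi : ∑ x, P x ^ 2 / Q x ≤ 1 + η ^ 2 := by
    have h1 : ∑ x, (P x - Q x) ^ 2 / Q x ≤ ∑ x, η ^ 2 * Q x := by
      refine Finset.sum_le_sum fun x _ => ?_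
      rw [div_le_iff₀ (hQ0 x), ← sq_abs]
      calc |P x - Q x| ^ 2 ≤ (η * Q x) ^ 2 := pow_le_pow_left₀ (abs_nonneg _) (h x) 2
        _ = η ^ 2 * Q x * Q x := by ring
    rw [sum_sub_sq_div hQ0 hP hQ, ← Finset.mul_sum, hQ] at h1
    linarith
  -- Cauchy–Schwarz bounds the squared `L¹` distance by `χ²`, and one plus `χ²` is multiplicative
  -- over independent samples.
  have hcs := Finset.sq_sum_div_le_sum_sq_div (Finset.univ : Finset (Fin N → Ω))
    (fun s => |∏ j, P (s j) - ∏ j, Q (s j)|) (g := fun s => ∏ j, Q (s j)) fun s _ => hQN s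
  rw [sum_pi_prod_eq_one hQ, div_one] at hcs
  simp only [sq_abs] at hcs
  rw [sum_sub_sq_div hQN (sum_pi_prod_eq_one hP N) (sum_pi_prod_eq_one hQ N)] at hcs
  refine hcs.trans (sub_le_sub_right ?_ 1)
  simp only [← Finset.prod_pow, ← Finset.prod_div_distrib]
  rw [← Fintype.sum_pow (fun x => P x ^ 2 / Q x) N]
  exact pow_le_pow_left₀ (Finset.sum_nonneg fun x _ => div_nonneg (sq_nonneg _) (hQ0 x).le) hchi N

end TotalVariation

/-! ### Assouad's lemma. -/

section Assouad

variable {m : ℕ} {Ω : Type*} [Fintype Ω]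

/-- Assouad's lemma: if flipping one bit of `b` moves the law `D b` by at most `τ` in `L¹`, then
for some `b` any tests `W` err on average on a fraction of at least `(1 - τ) / 2` of the bits. Here
`W k c s` is the probability that the guess of the bit `k` from the data `s` differs from `c`. -/
theorem exists_le_sum_test_error (D : (Fin m → Bool) → Ω → ℝ) (hD : ∀ b, ∑ s, D b s = 1) {τ : ℝ}
    (hτ : ∀ b k, ∑ s, |D b s - D (Function.update b k (!b k)) s| ≤ τ)
    (W : Fin m → Bool → Ω → ℝ) (hW0 : ∀ k c s, 0 ≤ W k c s)
    (hW1 : ∀ k c s, W k c s + W k (!c) s = 1) :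
    ∃ b, m * ((1 - τ) / 2) ≤ ∑ k, ∑ s, D b s * W k (b k) s := by
  have hpair : ∀ k b, 1 - τ ≤ ∑ s, D b s * W k (b k) s +
      ∑ s, D (Function.update b k (!b k)) s * W k (Function.update b k (!b k) k) s := by
    intro k b
    rw [Function.update_self, ← Finset.sum_add_distrib]
    have h : ∀ s, D (Function.update b k (!b k)) s -
        |D b s - D (Function.update b k (!b k)) s| ≤
        D b s * W k (b k) s + D (Function.update b k (!b k)) s * W k (!b k) s := by
      intro s
      have h1 := hW1 k (b k) s
      have h2 := hW0 k (b k) s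
      have h3 := hW0 k (!b k) s
      have h4 : W k (!b k) s = 1 - W k (b k) s := by linarith
      rw [h4]
      have h5 := mul_le_mul_of_nonneg_right
        (neg_abs_le (D b s - D (Function.update b k (!b k)) s)) h2
      have h6 : |D b s - D (Function.update b k (!b k)) s| * W k (b k) s ≤
          |D b s - D (Function.update b k (!b k)) s| :=
        mul_le_of_le_one_right (abs_nonneg _) (by linarith)
      linarith
    have h2 := Finset.sum_le_sum fun s (_ : s ∈ Finset.univ) => h s
    rw [Finset.sum_sub_distrib, hD] at h2
    linarith [hτ b k]
  -- Flipping bit `k` is an involution of the cube, so in the average over `b` both terms of `hpair`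
  -- have the same sum.
  have hflip : ∀ k, ∑ b : Fin m → Bool, ∑ s, D (Function.update b k (!b k)) s *
      W k (Function.update b k (!b k) k) s = ∑ b : Fin m → Bool, ∑ s, D b s * W k (b k) s := by
    intro k
    have hinv : Function.Involutive fun b : Fin m → Bool => Function.update b k (!b k) := by
      intro b
      simp
    exact Fintype.sum_equiv hinv.toPerm _ _ fun b => rfl
  have hk : ∀ k, ∑ _b : Fin m → Bool, (1 - τ) / 2 ≤
      ∑ b : Fin m → Bool, ∑ s, D b s * W k (b k) s := by
    intro k
    have h := Finset.sum_le_sum fun b (_ : b ∈ Finset.univ) => hpair k b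
    rw [Finset.sum_add_distrib, hflip] at h
    rw [← Finset.sum_div]
    linarith
  have hall : ∑ _b : Fin m → Bool, m * ((1 - τ) / 2) ≤
      ∑ b : Fin m → Bool, ∑ k, ∑ s, D b s * W k (b k) s := by
    rw [Finset.sum_comm (s := Finset.univ) (t := (Finset.univ : Finset (Fin m)))]
    refine le_trans (le_of_eq ?_) (Finset.sum_le_sum fun k _ => hk k)
    rw [Finset.sum_const, Finset.sum_const, Finset.sum_const]
    simp only [Finset.card_univ, nsmul_eq_mul, Fintype.card_fin]
    ring
  obtain ⟨b, -, hb⟩ := Finset.exists_le_of_sum_le Finset.univ_nonempty hall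
  exact ⟨b, hb⟩

end Assouad

/-! ### Neighbouring hard instances are close. -/

section Hard

variable {m : ℕ} {δ : ℝ}

/-- The two channels differ only when the hubs disagree, and then by `2 * δ`; the reference
probability is at least `1 / 2 - δ ≥ 1 / 4`. -/
theorem abs_leafChannel_not_sub_le (hδ : 0 < δ) (hδ' : δ ≤ 1 / 4) (b : Bool) (s : Bool × Bool)
    (a : Bool) :
    |leafChannel (hardCopy δ) b s a - leafChannel (hardCopy δ) (!b) s a| ≤
      8 * δ * leafChannel (hardCopy δ) (!b) s a := by
  obtain ⟨y, z⟩ := s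
  have hd : δ * δ ≤ δ * (1 / 4) := mul_le_mul_of_nonneg_left hδ' hδ.le
  have hd0 : 0 < δ * δ := mul_pos hδ hδ
  cases b <;> cases y <;> cases z <;> cases a <;>
    norm_num [leafChannel, hardCopy, bsc, abs_le] <;>
    (try constructor) <;> linarith

theorem starDensity_eq_mul_leafChannel (t : Bool × Bool → ℝ) (b : Fin m → Bool) (k : Fin m)
    (x : Fin (m + 2) → Bool) : starDensity t b x =
      hubWeight (x 0, x 1) *
        (∏ l ∈ Finset.univ.erase k, leafChannel t (b l) (x 0, x 1) (x l.succ.succ)) *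
        leafChannel t (b k) (x 0, x 1) (x k.succ.succ) := by
  rw [starDensity, ← Finset.prod_erase_mul _ _ (Finset.mem_univ k), mul_assoc]

theorem abs_starDensity_update_sub_le (hδ : 0 < δ) (hδ' : δ ≤ 1 / 4) (b : Fin m → Bool)
    (k : Fin m) (x : Fin (m + 2) → Bool) :
    |starDensity (hardCopy δ) b x - starDensity (hardCopy δ) (Function.update b k (!b k)) x| ≤
      8 * δ * starDensity (hardCopy δ) (Function.update b k (!b k)) x := by
  have hpos : ∀ c s a, 0 < leafChannel (hardCopy δ) c s a := fun c s a =>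
    bsc_pos (hardCopy_pos hδ s) (hardCopy_lt_one hδ' s) _ _
  have hrest : ∏ l ∈ Finset.univ.erase k, leafChannel (hardCopy δ)
      (Function.update b k (!b k) l) (x 0, x 1) (x l.succ.succ) =
      ∏ l ∈ Finset.univ.erase k, leafChannel (hardCopy δ) (b l) (x 0, x 1) (x l.succ.succ) := by
    refine Finset.prod_congr rfl fun l hl => ?_
    rw [Function.update_of_ne (Finset.ne_of_mem_erase hl)]
  have hR : 0 < hubWeight (x 0, x 1) *
      ∏ l ∈ Finset.univ.erase k, leafChannel (hardCopy δ) (b l) (x 0, x 1) (x l.succ.succ) :=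
    mul_pos (hubWeight_pos _) (Finset.prod_pos fun l _ => hpos _ _ _)
  have h := mul_le_mul_of_nonneg_left
    (abs_leafChannel_not_sub_le hδ hδ' (b k) (x 0, x 1) (x k.succ.succ)) hR.le
  rw [← abs_of_pos hR, ← abs_mul, abs_of_pos hR] at h
  rw [starDensity_eq_mul_leafChannel _ _ k, starDensity_eq_mul_leafChannel _ _ k, hrest,
    Function.update_self, ← mul_sub, mul_left_comm]
  exact h

theorem sum_abs_prod_starDensity_sub_le (hδ : 0 < δ) (hδ' : δ ≤ 1 / 4) {N : ℕ}
    (hN : (N : ℝ) * (64 * δ ^ 2) ≤ 1 / 37) (b : Fin m → Bool) (k : Fin m) :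
    ∑ s : Fin N → Fin (m + 2) → Bool, |∏ j, starDensity (hardCopy δ) b (s j) -
      ∏ j, starDensity (hardCopy δ) (Function.update b k (!b k)) (s j)| ≤ 1 / 6 := by
  have h := sq_sum_abs_prod_sub_prod_le (starDensity_pos (hardCopy_pos hδ) (hardCopy_lt_one hδ')
    (Function.update b k (!b k))) (sum_starDensity (hardCopy δ) b) (sum_starDensity _ _)
    (abs_starDensity_update_sub_le hδ hδ' b k) N
  -- The target is `1 + (1 / 6) ^ 2`; `exp (1 / 37) ≤ 37 / 36` follows by inverting `1 - 1 / 37 ≤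
  -- exp (-1 / 37)`.
  have h1 : (1 + (8 * δ) ^ 2) ^ N ≤ 37 / 36 := by
    calc (1 + (8 * δ) ^ 2) ^ N ≤ Real.exp (64 * δ ^ 2) ^ N := by
          refine pow_le_pow_left₀ (by positivity) ?_ N
          linarith [Real.add_one_le_exp (64 * δ ^ 2)]
      _ = Real.exp (N * (64 * δ ^ 2)) := by rw [← Real.exp_nat_mul]
      _ ≤ Real.exp (1 / 37) := Real.exp_le_exp.2 hN
      _ ≤ 37 / 36 := by
          have h2 := Real.one_sub_le_exp_neg (1 / 37)
          rw [Real.exp_neg] at h2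
          have h3 := inv_anti₀ (by norm_num) h2
          rw [inv_inv] at h3
          exact h3.trans (by norm_num)
  refine abs_le_of_sq_le_sq' (a := ∑ s : Fin N → Fin (m + 2) → Bool, _) ?_ (by norm_num) |>.2
  linarith

end Hard

/-! ### From a learner to tests of the bits. -/

section Learner

variable {n N : ℕ}

theorem toReal_errorProb (A : Learner n N) (P : PMF (Fin n → Bool)) (ε : ℝ)
    [DecidablePred (IsApproxTree P ε)] :
    (errorProb A P ε).toReal = ∑ s : Fin N → Fin n → Bool, (∏ j, (P (s j)).toReal) *
      ∑ T, (A s T).toReal * (if IsApproxTree P ε T then 0 else 1) := by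
  classical
  have hfin : ∀ s : Fin N → Fin n → Bool, (A s).toOuterMeasure {T | ¬ IsApproxTree P ε T} =
      ∑ T, (if IsApproxTree P ε T then 0 else A s T) := by
    intro s
    rw [PMF.toOuterMeasure_apply_fintype]
    refine Finset.sum_congr rfl fun T _ => ?_
    by_cases h : IsApproxTree P ε T <;> simp [h]
  have hT : ∀ (s : Fin N → Fin n → Bool) T, (if IsApproxTree P ε T then 0 else A s T) ≠ ∞ := by
    intro s T
    split_ifs
    · simp
    · exact (A s).apply_ne_top T
  rw [errorProb, ENNReal.toReal_sum]
  · refine Finset.sum_congr rfl fun s _ => ?_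
    rw [ENNReal.toReal_mul, ENNReal.toReal_prod, hfin, ENNReal.toReal_sum fun T _ => hT s T]
    congr 1
    refine Finset.sum_congr rfl fun T _ => ?_
    split_ifs <;> simp
  · intro s _
    rw [hfin]
    exact ENNReal.mul_ne_top (ENNReal.prod_ne_top fun j _ => P.apply_ne_top _)
      (ENNReal.sum_ne_top.2 fun T _ => hT s T)

theorem exists_rootParent (n : ℕ) (r : Fin n) :
    ∃ pa : SimpleGraph (Fin n) → Fin n → Fin n,
      ∀ T, T.IsTree → ∀ i, i ≠ r → IsParent T r (pa T i) i := by
  classical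
  refine ⟨fun T => if h : T.Connected then (exists_parent T h r).choose else fun _ => r,
    fun T hT => ?_⟩
  simp only [dif_pos hT.1]
  exact (exists_parent T hT.1 r).choose_spec

/-- A learner that succeeds on all hard instances needs many samples to do so. -/
theorem lt_mul_of_errorProb_lt {m : ℕ} (hm : 0 < m) {δ ε : ℝ} (hδ : 0 < δ) (hδ' : δ ≤ 1 / 4)
    (hε : 0 ≤ ε) (hεδ : ε ≤ m * δ / 60) (A : Learner (m + 2) N)
    (hA : ∀ P : PMF (Fin (m + 2) → Bool), errorProb A P ε < 1 / 3) :
    1 / 37 < (N : ℝ) * (64 * δ ^ 2) := by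
  classical
  by_contra! hN
  obtain ⟨pa, hpa⟩ := exists_rootParent (m + 2) 0
  have ha0 : ∀ s T, 0 ≤ (A s T).toReal := fun s T => ENNReal.toReal_nonneg
  obtain ⟨b, hb⟩ := exists_le_sum_test_error
    (fun (b : Fin m → Bool) (s : Fin N → Fin (m + 2) → Bool) =>
      ∏ j, starDensity (hardCopy δ) b (s j))
    (fun b => sum_pi_prod_eq_one (sum_starDensity _ _) N)
    (sum_abs_prod_starDensity_sub_le hδ hδ' hN)
    -- The guess for bit `k` is whether leaf `k` has hub `1` as parent when the output is rooted at
    -- hub `0`.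
    (fun k c s => ∑ T, (A s T).toReal * (if decide (pa T k.succ.succ = 1) = c then 0 else 1))
    (fun k c s => Finset.sum_nonneg fun T _ => by
      split_ifs <;> simp)
    (fun k c s => by
      rw [← Finset.sum_add_distrib]
      refine Eq.trans ?_ (sum_toReal_eq_one (A s))
      refine Finset.sum_congr rfl fun T _ => ?_
      cases c <;> by_cases h : pa T k.succ.succ = 1 <;> simp [h])
  have herr : (errorProb A (hardPMF hδ hδ' b) ε).toReal < 1 / 3 := by
    have h := (ENNReal.toReal_lt_toReal (hA _).ne_top (by norm_num)).2 (hA (hardPMF hδ hδ' b))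
    simpa using h
  -- An approximate tree misattaches at most `5 * ε / δ ≤ m / 12` leaves, and a wrong guess implies
  -- a misattached leaf; any other output is charged all `m` bits.
  have hwrong : ∀ T, ∑ k : Fin m, (if decide (pa T k.succ.succ = 1) = b k then (0 : ℝ) else 1) ≤
      m / 12 + m * (if IsApproxTree (hardPMF hδ hδ' b) ε T then 0 else 1) := by
    intro T
    split_ifs with hT
    · have h := card_ne_hubParent_le hε hT (hpa T hT.1)
      have hle : ∑ k : Fin m, (if decide (pa T k.succ.succ = 1) = b k then (0 : ℝ) else 1) ≤
          ∑ k : Fin m, (if pa T k.succ.succ = hubParent b k.succ.succ then 0 else 1) := by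
        refine Finset.sum_le_sum fun k _ => ?_
        rw [hubParent_leaf]
        cases hbk : b k
        · by_cases h0 : pa T k.succ.succ = 0
          · simp [h0]
          · simp only [Bool.false_eq_true, if_false, h0]
            split_ifs <;> norm_num
        · by_cases h1 : pa T k.succ.succ = 1 <;> simp [h1]
      have h2 : δ * ∑ k : Fin m, (if decide (pa T k.succ.succ = 1) = b k then (0 : ℝ) else 1) ≤
          δ * (m / 12) := by
        have := mul_le_mul_of_nonneg_left hle hδ.le
        linarith
      linarith [le_of_mul_le_mul_left h2 hδ]
    · have h : ∑ k : Fin m, (if decide (pa T k.succ.succ = 1) = b k then (0 : ℝ) else 1) ≤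
          ∑ _k : Fin m, 1 := Finset.sum_le_sum fun k _ => by split_ifs <;> norm_num
      simp only [Finset.sum_const, Finset.card_univ, Fintype.card_fin, nsmul_eq_mul] at h
      have hm0 : (0 : ℝ) ≤ m := Nat.cast_nonneg m
      linarith
  have hs : ∀ s : Fin N → Fin (m + 2) → Bool,
      ∑ k : Fin m, ∑ T, (A s T).toReal * (if decide (pa T k.succ.succ = 1) = b k then 0 else 1) ≤
        m / 12 + m * ∑ T, (A s T).toReal *
          (if IsApproxTree (hardPMF hδ hδ' b) ε T then 0 else 1) := by
    intro s
    rw [Finset.sum_comm]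
    simp only [← Finset.mul_sum]
    refine (Finset.sum_le_sum fun T _ =>
      mul_le_mul_of_nonneg_left (hwrong T) (ha0 s T)).trans (le_of_eq ?_)
    simp only [mul_add, Finset.sum_add_distrib, ← Finset.sum_mul, sum_toReal_eq_one, one_mul,
      Finset.mul_sum]
    congr 1
    exact Finset.sum_congr rfl fun T _ => by ring
  have hupper : ∑ k : Fin m, ∑ s : Fin N → Fin (m + 2) → Bool,
      (∏ j, starDensity (hardCopy δ) b (s j)) *
        ∑ T, (A s T).toReal * (if decide (pa T k.succ.succ = 1) = b k then 0 else 1) ≤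
      m / 12 + m * (errorProb A (hardPMF hδ hδ' b) ε).toReal := by
    rw [Finset.sum_comm, toReal_errorProb]
    simp only [toReal_hardPMF, ← Finset.mul_sum]
    refine (Finset.sum_le_sum fun s _ => mul_le_mul_of_nonneg_left (hs s)
      (Finset.prod_nonneg fun j _ =>
        (starDensity_pos (hardCopy_pos hδ) (hardCopy_lt_one hδ') b _).le)).trans (le_of_eq ?_)
    simp only [mul_add, Finset.sum_add_distrib, ← Finset.sum_mul,
      sum_pi_prod_eq_one (sum_starDensity _ _), one_mul]
    congr 1
    rw [Finset.mul_sum]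
    exact Finset.sum_congr rfl fun s _ => by ring
  -- With `τ = 1 / 6` the lower bound is `5 * m / 12`, while the upper bound is strictly below `m /
  -- 12 + m / 3`, the same number.
  have h1 := hb.trans hupper
  have hm0 : (0 : ℝ) < m := Nat.cast_pos.2 hm
  have h2 := mul_lt_mul_of_pos_left herr hm0
  linarith

end Learner

end TreeLearning

end

/-! ### Choice of constants. -/

theorem theorem7p3 :
    ∃ c : ℝ, 0 < c ∧ ∃ ε₀ : ℝ, 0 < ε₀ ∧
      ∀ (n : ℕ), 3 ≤ n → ∀ (ε : ℝ), 0 < ε → ε ≤ ε₀ * (n : ℝ) →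
        ∀ (N : ℕ) (A : TreeLearning.Learner n N),
          (∀ P : PMF (Fin n → Bool), TreeLearning.errorProb A P ε < 1 / 3) →
            c * (n : ℝ) ^ 2 / ε ^ 2 ≤ (N : ℝ) := by
  -- The choice `δ = 60 * ε / m` makes `ε = m * δ / 60`. The factor `9` comes from `n ≤ 3 * m`, and
  -- `ε ≤ n / 720 ≤ m / 240` gives `δ ≤ 1 / 4`.
  refine ⟨1 / (37 * 64 * 60 ^ 2 * 9), by norm_num, 1 / 720, by norm_num, ?_⟩
  intro n hn ε hε hεn N A hA
  obtain ⟨m, rfl⟩ : ∃ m, n = m + 2 := ⟨n - 2, by omega⟩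
  have hm : 0 < m := by omega
  have hm1 : (1 : ℝ) ≤ m := by exact_mod_cast hm
  have hm0 : (0 : ℝ) < m := by linarith
  have hnm : ((m + 2 : ℕ) : ℝ) ≤ 3 * m := by
    push_cast
    linarith
  have hδ : 0 < 60 * ε / m := by positivity
  have hδ' : 60 * ε / m ≤ 1 / 4 := by
    rw [div_le_iff₀ hm0]
    linarith
  have h := TreeLearning.lt_mul_of_errorProb_lt hm hδ hδ' hε.le
    (le_of_eq (by field_simp)) A hA
  have hsq : ((m + 2 : ℕ) : ℝ) ^ 2 ≤ (3 * m) ^ 2 := pow_le_pow_left₀ (Nat.cast_nonneg _) hnm 2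
  rw [div_pow, ← mul_div_assoc, ← mul_div_assoc, lt_div_iff₀ (by positivity)] at h
  rw [div_le_iff₀ (by positivity)]
  linarith
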